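/- Let $k$ be an algebraically closed field of characteristic $0$. For $A,B\subseteq k$ write $A\equiv_p B$ if there are polynomials $P,Q\in k[X]$ with $A=P^{-1}(B)$ and $B=Q^{-1}(A)$. Let $\mathcal P_3$ be the set of $3$-element subsets of $k$ and $\Sigma_3=\mathcal P_3/{\equiv_p}$ the set of polynomial classes of $3$-element subsets of $k$. Put $f_3=\prod_{i\neq j}(X_i-X_j)\in k[X_1,X_2,X_3]$ (product over ordered pairs of distinct indices) and let $D(f_3)\subseteq k^3$ be the standard open set of triples with pairwise distinct coordinates. Give $\mathcal P_3$ the structure of quotient of the variety $D(f_3)$ by the map $\theta:(a_1,a_2,a_3)\mapsto\{a_1,a_2,a_3\}$, and $\Sigma_3$ the structure of quotient of $\mathcal P_3$ by the projection $\theta':A\mapsto[A]$; that is, each carries the quotient topology of the Zariski topology, and a $k$-valued function on an open subset is regular if and only if its pullback under the quotient map is regular. Then $\Sigma_3$ is isomorphic to the affine line over $k$: there is a bijection $\Sigma_3\to k$ which, together with its inverse, is continuous and pulls regular functions on open sets back to regular functions. Moreover, a function $F:\Sigma_3\to k$ is regular on $\Sigma_3$ if and only if there are $r\in\mathbb N$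 and a symmetric, translation-invariant polynomial $g\in k[X_1,X_2,X_3]$, homogeneous of degree $6r$ (possibly $g=0$), such that $$F([\{a_1,a_2,a_3\}])=\frac{g(a_1,a_2,a_3)}{f_3(a_1,a_2,a_3)^r}\qquad\text{for all }(a_1,a_2,a_3)\in D(f_3).$$ Here $g$ is translation invariant if $g(a_1,a_2,a_3)=g(a_1+t,a_2+t,a_3+t)$ for all $a_1,a_2,a_3,t\in k$. -/

import Mathlib

open TopologicalSpace

namespace PolynomialClasses

universe u

/-! ## Polynomial reducibility -/

section Reducibility

variable {k : Type u} [Field k]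

/-- `A` polynomially reduces to `B`: there is a polynomial `P` with `A = P⁻¹(B)`. -/
def PolRed (A B : Set k) : Prop :=
  ∃ P : Polynomial k, A = (fun x : k => P.eval x) ⁻¹' B

theorem PolRed.refl (A : Set k) : PolRed A A :=
  ⟨Polynomial.X, by ext x; simp⟩

theorem PolRed.trans {A B C : Set k} (h₁ : PolRed A B) (h₂ : PolRed B C) : PolRed A C := by
  obtain ⟨P, rfl⟩ := h₁
  obtain ⟨Q, rfl⟩ := h₂
  exact ⟨Q.comp P, by ext x; simp [Polynomial.eval_comp]⟩

variable (k) in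
/-- Polynomial bireducibility, an equivalence relation on subsets of `k`. -/
def polEquiv : Setoid (Set k) where
  r A B := PolRed A B ∧ PolRed B A
  iseqv :=
    { refl := fun A => ⟨PolRed.refl A, PolRed.refl A⟩
      symm := fun h => ⟨h.2, h.1⟩
      trans := fun h₁ h₂ => ⟨h₁.1.trans h₂.1, h₂.2.trans h₁.2⟩ }

variable (k) in
/-- The `n`-element subsets of `k`. -/
abbrev NSubset (n : ℕ) : Type u := {A : Set k // A.encard = n}

variable (k) in
/-- The set of polynomial classes of `n`-element subsets of `k`. -/
abbrev PolClass (n : ℕ) : Type u :=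
  Quotient ((polEquiv k).comap (Subtype.val : NSubset k n → Set k))

end Reducibility

/-! ## Spaces with functions -/

/-- Precomposition with a map, as a homomorphism of algebras of functions. -/
def precomp (k : Type u) [Field k] {S T : Type u} (φ : S → T) : (T → k) →ₐ[k] (S → k) where
  toFun f := f ∘ φ
  map_one' := rfl
  map_mul' _ _ := rfl
  map_zero' := rfl
  map_add' _ _ := rfl
  commutes' _ := rfl

/-- A topological space with a sheaf of `k`-algebras of `k`-valued functions, called the
regular functions. Classical varieties over an algebraically closed field are such spaces. -/
structure SpaceWithFunctions (k : Type u) [Field k] where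
  /-- The points. -/
  carrier : Type u
  /-- The topology. -/
  topology : TopologicalSpace carrier
  /-- The regular functions on an open set. -/
  regular : (U : Opens carrier) → Subalgebra k (U → k)
  /-- Restrictions of regular functions are regular. -/
  restrict : ∀ {U V : Opens carrier} (h : U ≤ V) (f : V → k),
    f ∈ regular V → (fun x : U => f ⟨x.1, h x.2⟩) ∈ regular U
  /-- Functions that are locally regular are regular. -/
  glue : ∀ (U : Opens carrier) (f : U → k),
    (∀ x : U, ∃ (V : Opens carrier) (h : V ≤ U), x.1 ∈ V ∧
      (fun y : V => f ⟨y.1, h y.2⟩) ∈ regular V) → f ∈ regular U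

attribute [instance] SpaceWithFunctions.topology

namespace SpaceWithFunctions

variable {k : Type u} [Field k]

/-- A morphism: a continuous map that pulls regular functions back to regular functions. -/
def IsMorphism (X Y : SpaceWithFunctions k) (φ : X.carrier → Y.carrier) : Prop :=
  ∃ hφ : Continuous φ, ∀ (V : Opens Y.carrier) (f : V → k), f ∈ Y.regular V →
    (fun x : Opens.comap ⟨φ, hφ⟩ V => f ⟨φ x.1, x.2⟩) ∈ X.regular (Opens.comap ⟨φ, hφ⟩ V)

/-- Two spaces are isomorphic: there are mutually inverse morphisms between them. -/
def Isomorphic (X Y : SpaceWithFunctions k) : Prop :=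
  ∃ e : X.carrier ≃ Y.carrier, IsMorphism X Y e ∧ IsMorphism Y X e.symm

/-- The globally regular functions, as functions on the set of points. -/
def globalFunctions (X : SpaceWithFunctions k) : Subalgebra k (X.carrier → k) :=
  (X.regular ⊤).comap (precomp k (fun x : (⊤ : Opens X.carrier) => x.1))

/-- The quotient of a space along a map `q : X → Y` (used for surjective `q`): `Y` carries the
quotient topology, and a function on an open set of `Y` is regular if and only if its pullback
to `X` is regular. -/
def quotient (X : SpaceWithFunctions k) {Y : Type u} (q : X.carrier → Y) :
    SpaceWithFunctions k :=
  letI : TopologicalSpace Y := coinduced q X.topology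
  { carrier := Y
    topology := coinduced q X.topology
    regular := fun U =>
      (X.regular (Opens.comap ⟨q, continuous_coinduced_rng⟩ U)).comap
        (precomp k (fun x : Opens.comap ⟨q, continuous_coinduced_rng⟩ U =>
          (⟨q x.1, x.2⟩ : U)))
    restrict := fun {U V} h f hf =>
      X.restrict (U := Opens.comap ⟨q, continuous_coinduced_rng⟩ U)
        (V := Opens.comap ⟨q, continuous_coinduced_rng⟩ V) (fun _ hx => h hx) _ hf
    glue := fun U f hf => by
      refine X.glue _ _ fun x => ?_
      obtain ⟨V, h, hxV, hV⟩ := hf ⟨q x.1, x.2⟩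
      exact ⟨Opens.comap ⟨q, continuous_coinduced_rng⟩ V, fun _ hx => h hx, hxV, hV⟩ }

end SpaceWithFunctions

/-! ## Affine space and its standard open sets -/

section Affine

variable (k : Type u) [Field k] (n : ℕ)

/-- The common zeros in `kⁿ` of a set of polynomials. -/
def zeros (S : Set (MvPolynomial (Fin n) k)) : Set (Fin n → k) :=
  {a | ∀ f ∈ S, MvPolynomial.eval a f = 0}

/-- The Zariski topology on `kⁿ`: the closed sets are the sets of common zeros. -/
@[reducible] def zariski : TopologicalSpace (Fin n → k) :=
  TopologicalSpace.ofClosed (Set.range (zeros k n))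
    ⟨{1}, by ext a; simp [zeros]⟩
    (by
      intro A hA
      refine ⟨{f | ∃ S, zeros k n S ∈ A ∧ f ∈ S}, ?_⟩
      ext a
      constructor
      · intro h T hT
        obtain ⟨S, rfl⟩ := hA hT
        exact fun f hf => h f ⟨S, hT, hf⟩
      · rintro h f ⟨S, hS, hf⟩
        exact h _ hS f hf)
    (by
      rintro _ ⟨S, rfl⟩ _ ⟨T, rfl⟩
      refine ⟨{f | ∃ g ∈ S, ∃ h ∈ T, f = g * h}, ?_⟩
      ext a
      constructor
      · intro H
        by_contra hc
        simp only [Set.mem_union, not_or, zeros, Set.mem_ofPred_eq, not_forall] at hc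
        obtain ⟨⟨g, hg, hga⟩, ⟨h, hh, hha⟩⟩ := hc
        have := H (g * h) ⟨g, hg, h, hh, rfl⟩
        rw [map_mul] at this
        exact (mul_ne_zero hga hha) this
      · rintro (H | H) f ⟨g, hg, h, hh, rfl⟩
        · rw [map_mul, H g hg, zero_mul]
        · rw [map_mul, H h hh, mul_zero])

variable {k n}

/-- A set `Y` embedded in `kⁿ` by `ι` (used for injective `ι`), with the induced Zariski topology;
a function on an open set is regular if it is, locally at each point, a quotient of two
polynomials whose denominator does not vanish. -/
def subspace {Y : Type u} (ι : Y → (Fin n → k)) : SpaceWithFunctions k :=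
  letI : TopologicalSpace Y := induced ι (zariski k n)
  { carrier := Y
    topology := induced ι (zariski k n)
    regular := fun U =>
      { carrier := {f | ∀ x : U, ∃ V : Opens Y, x.1 ∈ V ∧
          ∃ g h : MvPolynomial (Fin n) k, ∀ y : U, y.1 ∈ V →
            MvPolynomial.eval (ι y.1) h ≠ 0 ∧
            f y = MvPolynomial.eval (ι y.1) g / MvPolynomial.eval (ι y.1) h}
        mul_mem' := by
          intro f f' hf hf' x
          obtain ⟨V, hV, g, h, H⟩ := hf x
          obtain ⟨V', hV', g', h', H'⟩ := hf' x
          refine ⟨V ⊓ V', ⟨hV, hV'⟩, g * g', h * h', fun y hy => ?_⟩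
          obtain ⟨a, b⟩ := H y hy.1
          obtain ⟨a', b'⟩ := H' y hy.2
          rw [map_mul, map_mul, Pi.mul_apply, b, b']
          exact ⟨mul_ne_zero a a', div_mul_div_comm _ _ _ _⟩
        add_mem' := by
          intro f f' hf hf' x
          obtain ⟨V, hV, g, h, H⟩ := hf x
          obtain ⟨V', hV', g', h', H'⟩ := hf' x
          refine ⟨V ⊓ V', ⟨hV, hV'⟩, g * h' + h * g', h * h', fun y hy => ?_⟩
          obtain ⟨a, b⟩ := H y hy.1
          obtain ⟨a', b'⟩ := H' y hy.2
          rw [map_mul, map_add, map_mul, map_mul, Pi.add_apply, b, b']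
          exact ⟨mul_ne_zero a a', div_add_div _ _ a a'⟩
        algebraMap_mem' := by
          intro c x
          exact ⟨⊤, trivial, MvPolynomial.C c, 1, fun y _ => by simp⟩ }
    restrict := fun {U V} h f hf x => by
      obtain ⟨W, hW, g, g', H⟩ := hf ⟨x.1, h x.2⟩
      exact ⟨W, hW, g, g', fun y hy => H ⟨y.1, h y.2⟩ hy⟩
    glue := fun U f hf x => by
      obtain ⟨V, hVU, hxV, hV⟩ := hf x
      obtain ⟨W, hW, g, g', H⟩ := hV ⟨x.1, hxV⟩
      exact ⟨V ⊓ W, ⟨hxV, hW⟩, g, g', fun y hy => H ⟨y.1, hy.1⟩ hy.2⟩ }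

variable (k n)

/-- Affine `n`-space over `k`; the affine line is the case `n = 1`. -/
def affineSpace : SpaceWithFunctions k := subspace (id : (Fin n → k) → (Fin n → k))

/-- The polynomial `fₙ = ∏_{i ≠ j} (Xᵢ - Xⱼ)`, over ordered pairs of distinct indices. -/
noncomputable def discPoly : MvPolynomial (Fin n) k :=
  ∏ p ∈ (Finset.univ : Finset (Fin n)).offDiag, (MvPolynomial.X p.1 - MvPolynomial.X p.2)

/-- The points of the standard open set `D(fₙ)`. -/
abbrev DistinctTuple : Type u := {a : Fin n → k // MvPolynomial.eval a (discPoly k n) ≠ 0}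

/-- The standard open set `D(fₙ)` of affine space, consisting of the points of `kⁿ` with
pairwise distinct coordinates. -/
def distinctTuples : SpaceWithFunctions k :=
  subspace (Subtype.val : DistinctTuple k n → (Fin n → k))

variable {k n}

theorem eval_discPoly_ne_zero_iff (a : Fin n → k) :
    MvPolynomial.eval a (discPoly k n) ≠ 0 ↔ Function.Injective a := by
  simp only [discPoly, map_prod, map_sub, MvPolynomial.eval_X, Finset.prod_ne_zero_iff,
    Finset.mem_offDiag, Finset.mem_univ, true_and, sub_ne_zero, Prod.forall]
  exact ⟨fun h i j hij => by_contra fun hne => h i j hne hij, fun h i j hne hij => hne (h hij)⟩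

/-- The projection `θ : D(fₙ) → 𝒫ₙ`, `(a₁, …, aₙ) ↦ {a₁, …, aₙ}`. Its fibres are the orbits of
the symmetric group acting by permutations of the coordinates. -/
def toSet (a : DistinctTuple k n) : NSubset k n :=
  ⟨Set.range a.1, by
    rw [← Set.image_univ, ((eval_discPoly_ne_zero_iff a.1).1 a.2).encard_image]
    simp⟩

variable (k n)

/-- The variety `𝒫ₙ` of `n`-element subsets of `k`: the quotient of `D(fₙ)` by the symmetric
group. -/
def setVariety : SpaceWithFunctions k :=
  (distinctTuples k n).quotient (toSet : DistinctTuple k n → NSubset k n)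

/-- The variety `Σₙ` of polynomial classes of `n`-element subsets of `k`: the quotient of `𝒫ₙ` by
polynomial bireducibility. -/
def classVariety : SpaceWithFunctions k :=
  (setVariety k n).quotient
    (fun A : NSubset k n => (Quotient.mk _ A : PolClass k n))

variable {k n}

/-- The polynomial class of the set of coordinates of a tuple with distinct coordinates. -/
def classOf (a : DistinctTuple k n) : (classVariety k n).carrier :=
  (Quotient.mk _ (toSet a) : PolClass k n)

/-- A polynomial is translation invariant if `h(a₁, …, aₙ) = h(a₁ + t, …, aₙ + t)` always. -/
def TranslationInvariant (h : MvPolynomial (Fin n) k) : Prop :=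
  ∀ (a : Fin n → k) (t : k),
    MvPolynomial.eval a h = MvPolynomial.eval (fun i => a i + t) h

end Affine

end PolynomialClasses

/-! Counting preimages with multiplicity, as in Riemann-Hurwitz, shows that a polynomial pulling a
finite set of at least two points back to a set of the same size has degree one
(`natDegree_eq_one_of_preimage`). So polynomial classes of triples are orbits under affine maps, and
every class contains some `{0, 1, x}`. The quotient `jInv` of two symmetric, translation-invariant
forms of degree 6 is constant on classes. On `(0, 1, x)` it is, up to a constant, the classical
j-function of the Legendre parameter: its fibres are the orbits of the six Möbius maps permuting `0,
1, ∞`, which correspond to relabelling the triple. Hence `jInv` is a bijection from classes to `k`.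

Continuity and regularity of this bijection follow by clearing powers of the discriminant. For the
inverse, everything is restricted to the curve of triples `(0, 1, x)`. There a nonempty open set is
cofinite, and a regular function is a single fraction `G / H` in lowest terms
(`exists_eq_div_of_locally_eq_div`). Being constant on the fibres of `jInv`, it descends to a
fraction in `t = jInv` by averaging over the roots of a monic sextic over `k[t]`; the average is a
matrix trace (`exists_eq_div_of_eq_div_on_roots`).

A global function thus becomes a fraction whose denominator has no zeros, so a polynomial in `jInv`,
and `exists_eval_eq_mul_eval_jInv` puts it in the required form. -/

namespace PolynomialClasses

universe u

/-! ### Polynomials in one variable: gluing fractions, descent by traces, preimages of finite sets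
-/

section OneVariable

open Polynomial

variable {k : Type u} [Field k]

/-- In one variable, a function that is locally a quotient of polynomials on a cofinite set is
globally one. -/
theorem exists_eq_div_of_locally_eq_div [Infinite k] {W : Set k} (hW : Wᶜ.Finite) (ψ : k → k)
    (hψ : ∀ x ∈ W, ∃ g h : k[X], h.eval x ≠ 0 ∧
      ∀ y ∈ W, h.eval y ≠ 0 → ψ y = g.eval y / h.eval y) :
    ∃ G H : k[X], ∀ x ∈ W, H.eval x ≠ 0 ∧ ψ x = G.eval x / H.eval x := by
  have hne : W.Nonempty := by
    rw [Set.nonempty_iff_ne_empty]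
    rintro rfl
    exact Set.infinite_univ (by simpa using hW)
  obtain ⟨x₀, hx₀⟩ := hne
  obtain ⟨g, h, hh, hgh⟩ := hψ x₀ hx₀
  have h0 : h ≠ 0 := by rintro rfl; simp at hh
  -- Pass to lowest terms: a common zero of `g` and `h` could lie in `W`.
  obtain ⟨d, G, H, hd, hGH, hG, hH⟩ :
      ∃ d G H : k[X], d ≠ 0 ∧ IsCoprime G H ∧ g = d * G ∧ h = d * H := by
    classical
    have hd : EuclideanDomain.gcd g h ≠ 0 := fun h' => h0 (EuclideanDomain.gcd_eq_zero_iff.1 h').2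
    obtain ⟨G, hG⟩ := EuclideanDomain.gcd_dvd_left g h
    obtain ⟨H, hH⟩ := EuclideanDomain.gcd_dvd_right g h
    refine ⟨EuclideanDomain.gcd g h, G, H, hd, ?_, hG, hH⟩
    refine ⟨EuclideanDomain.gcdA g h, EuclideanDomain.gcdB g h, mul_left_cancel₀ hd ?_⟩
    have := EuclideanDomain.gcd_eq_gcd_ab g h
    calc _ = EuclideanDomain.gcd g h * G * EuclideanDomain.gcdA g h
          + EuclideanDomain.gcd g h * H * EuclideanDomain.gcdB g h := by ring
      _ = _ := by rw [← hG, ← hH, ← this, mul_one]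
  refine ⟨G, H, fun x hx => ?_⟩
  obtain ⟨g₁, h₁, hh₁, hgh₁⟩ := hψ x hx
  have h₁0 : h₁ ≠ 0 := by rintro rfl; simp at hh₁
  -- Both fractions equal `ψ` off a finite set, so the cross products agree identically.
  have key : G * h₁ = g₁ * H := by
    have hfin : (Wᶜ ∪ {y | (h * h₁).IsRoot y}).Finite :=
      hW.union (Polynomial.finite_setOfPred_isRoot (mul_ne_zero h0 h₁0))
    refine Polynomial.eq_of_infinite_eval_eq _ _ (hfin.infinite_compl.mono fun y hy => ?_)
    simp only [Set.mem_compl_iff, Set.mem_union, not_or, not_not, Set.mem_ofPred_eq, IsRoot.def,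
      eval_mul, mul_eq_zero] at hy ⊢
    obtain ⟨hyW, hy, hy₁⟩ := hy
    have e := (hgh y hyW hy).symm.trans (hgh₁ y hyW hy₁)
    rw [div_eq_div_iff hy hy₁, hG, hH, eval_mul, eval_mul] at e
    have hdy : d.eval y ≠ 0 := fun h' => hy (by rw [hH, eval_mul, h', zero_mul])
    exact mul_left_cancel₀ hdy (by linear_combination e)
  have keyx : G.eval x * h₁.eval x = g₁.eval x * H.eval x := by
    rw [← eval_mul, key, eval_mul]
  have hHx : H.eval x ≠ 0 := by
    intro h'
    rw [h', mul_zero] at keyx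
    obtain ⟨u, v, huv⟩ := hGH
    have := congrArg (Polynomial.eval x) huv
    simp [h', (mul_eq_zero.1 keyx).resolve_right hh₁] at this
  exact ⟨hHx, by rw [hgh₁ x hx hh₁, div_eq_div_iff hh₁ hHx]; exact keyx.symm⟩

/-- A polynomial vanishing at the roots of `p` has a power divisible by `p`. -/
theorem exists_dvd_pow_of_roots [IsAlgClosed k] {p q : k[X]} (hp : p ≠ 0)
    (h : ∀ x, p.eval x = 0 → q.eval x = 0) : ∃ n, p ∣ q ^ n := by
  -- Each linear factor of `p`, counted with multiplicity, divides one copy of `q`.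
  refine ⟨p.roots.card, ?_⟩
  have hs := (IsAlgClosed.splits p).eq_prod_roots
  rw [hs, C_mul_dvd (leadingCoeff_ne_zero.2 hp)]
  rw [← hs]
  calc (p.roots.map fun a => X - C a).prod ∣ (p.roots.map fun _ => q).prod :=
        Multiset.prod_dvd_prod_of_dvd _ _ fun a ha =>
          dvd_iff_isRoot.2 (h a (isRoot_of_mem_roots ha))
    _ = _ := by simp

/-- If a function of `t` has the value `G / H` at all roots of a monic polynomial `Φ` with
coefficients polynomial in `t`, then it is a quotient of polynomials in `t`. The quotient is
obtained from the trace of `G / H` in `k[t][X] / Φ`. -/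
theorem exists_eq_div_of_eq_div_on_roots [IsAlgClosed k] [CharZero k] (Φ : k[X][X])
    (hΦ : Φ.Monic) (hdeg : Φ.natDegree ≠ 0) (φ : k → k) (V : Set k) (G H : k[X])
    (h : ∀ t ∈ V, ∀ x, (Φ.map (evalRingHom t)).eval x = 0 →
      H.eval x ≠ 0 ∧ φ t = G.eval x / H.eval x) :
    ∃ a b : k[X], ∀ t ∈ V, b.eval t ≠ 0 ∧ φ t = a.eval t / b.eval t := by
  -- `M` is the matrix of multiplication by the root of `Φ` on the free module `k[t][X] / Φ`.
  obtain ⟨n, hn, M, hM⟩ : ∃ (n : ℕ), n ≠ 0 ∧ ∃ M : Matrix (Fin n) (Fin n) k[X], aeval M Φ = 0 := by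
    refine ⟨_, ?_, Algebra.leftMulMatrix (AdjoinRoot.powerBasis' hΦ).basis (AdjoinRoot.root Φ), ?_⟩
    · simpa using hdeg
    · rw [aeval_algHom_apply, AdjoinRoot.aeval_eq, AdjoinRoot.mk_self, map_zero]
  -- This is `tr(H(M)⁻¹ G(M)) / n` with the inverse written as adjugate over determinant, so that it
  -- makes sense over `k[t]`.
  refine ⟨((aeval M H).adjugate * aeval M G).trace, C (n : k) * (aeval M H).det, fun t ht => ?_⟩
  let ε : Matrix (Fin n) (Fin n) k[X] →ₐ[k] Matrix (Fin n) (Fin n) k := (aeval t).mapMatrix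
  set A := ε M with hA
  set p := Φ.map (evalRingHom t) with hp
  have hcomp : (algebraMap k (Matrix (Fin n) (Fin n) k)).comp (evalRingHom t) =
      (ε : Matrix (Fin n) (Fin n) k[X] →+* Matrix (Fin n) (Fin n) k).comp
        (algebraMap k[X] (Matrix (Fin n) (Fin n) k[X])) := by
    refine RingHom.ext fun f => ?_
    ext i j
    by_cases hij : i = j <;> simp [ε, Matrix.algebraMap_matrix_apply, hij]
  have hpA : aeval A p = 0 := by
    have := congrArg (ε : Matrix (Fin n) (Fin n) k[X] →+* Matrix (Fin n) (Fin n) k) hM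
    rw [aeval_def, hom_eval₂, map_zero, ← hcomp] at this
    rw [aeval_def, hp, eval₂_map]
    exact this
  have hp0 : p ≠ 0 := (hΦ.map _).ne_zero
  -- `H` has no zero among the roots of `p`, so `u(A)` inverts `H(A)`.
  obtain ⟨u, v, huv⟩ : IsCoprime H p := by
    refine (isCoprime_iff_aeval_ne_zero_of_isAlgClosed k k _ _).2 fun x => ?_
    by_cases hx : p.eval x = 0
    · left; simpa using (h t ht x hx).1
    · right; simpa using hx
  have huA : aeval A H * aeval A u = 1 := by
    have := congrArg (aeval A) huv
    rw [map_add, map_mul, map_mul, hpA, mul_zero, add_zero, map_one] at this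
    rwa [(Commute.all H u).map (aeval A)]
  have hdet : (aeval A H).det ≠ 0 := by
    intro h'
    have := congrArg Matrix.det huA
    rw [Matrix.det_mul, h', zero_mul, Matrix.det_one] at this
    exact zero_ne_one this
  have hadj : (aeval A H).adjugate = (aeval A H).det • aeval A u := by
    calc _ = (aeval A H).adjugate * (aeval A H * aeval A u) := by rw [huA, mul_one]
      _ = _ := by rw [← mul_assoc, Matrix.adjugate_mul, smul_mul_assoc, one_mul]
  -- `G - φ(t) H` vanishes at the roots of `p`, so `p` divides a power of it. Thus `u(A) G(A)` is
  -- `φ(t)` plus a nilpotent, and its trace is `n φ(t)`.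
  have hnil : IsNilpotent (aeval A (u * (G - C (φ t) * H))) := by
    obtain ⟨m, c, hc⟩ := exists_dvd_pow_of_roots (q := G - C (φ t) * H) hp0 fun x hx => by
      obtain ⟨h1, h2⟩ := h t ht x hx
      rw [eval_sub, eval_mul, eval_C, h2, div_mul_cancel₀ _ h1, sub_self]
    refine ⟨m, ?_⟩
    rw [← map_pow, mul_pow, hc, map_mul, map_mul, hpA, zero_mul, mul_zero]
  have htr : (aeval A u * aeval A G).trace = n * φ t := by
    have h0 := (Matrix.isNilpotent_trace_of_isNilpotent hnil).eq_zero
    have : aeval A (u * (G - C (φ t) * H)) = aeval A u * aeval A G - φ t • 1 := by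
      rw [← huA, (Commute.all H u).map (aeval A)]
      simp only [map_mul, map_sub, aeval_C, Algebra.algebraMap_eq_smul_one]
      rw [mul_sub, smul_mul_assoc, one_mul, mul_smul_comm]
    rw [this, Matrix.trace_sub, Matrix.trace_smul, Matrix.trace_one, sub_eq_zero] at h0
    simpa [mul_comm] using h0
  have hdetε : ((aeval M H).det).eval t = (aeval A H).det := by
    rw [hA, aeval_algHom_apply]
    exact (evalRingHom t).map_det _
  have htrε : (((aeval M H).adjugate * aeval M G).trace).eval t =
      ((aeval A H).adjugate * aeval A G).trace := by
    rw [hA, aeval_algHom_apply, aeval_algHom_apply]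
    have h1 : (ε (aeval M H)).adjugate = ε (aeval M H).adjugate :=
      ((evalRingHom t).map_adjugate _).symm
    rw [h1, ← map_mul]
    exact (AddMonoidHom.map_trace (evalRingHom t : k[X] →+ k) _)
  have hn' : (n : k) ≠ 0 := Nat.cast_ne_zero.2 hn
  rw [eval_mul, eval_C, hdetε, htrε, hadj, smul_mul_assoc, Matrix.trace_smul, htr, smul_eq_mul]
  refine ⟨mul_ne_zero hn' hdet, ?_⟩
  field_simp

/-- A nonconstant polynomial that pulls a finite set `B` back to a set of the same cardinality at
least two has degree one. -/
theorem natDegree_eq_one_of_preimage [IsAlgClosed k] [CharZero k] (P : k[X]) (A B : Finset k)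
    (hA : (A : Set k) = (fun x => P.eval x) ⁻¹' B) (hcard : A.card = B.card) (hB : 2 ≤ B.card) :
    P.natDegree = 1 := by
  classical
  have hA' (x : k) : x ∈ A ↔ P.eval x ∈ B := by
    rw [← Finset.mem_coe, hA]; rfl
  have hdeg : P.natDegree ≠ 0 := by
    intro h0
    obtain ⟨c, rfl⟩ := natDegree_eq_zero.1 h0
    obtain ⟨x, hx⟩ := Finset.card_pos.1 (show 0 < A.card by omega)
    have hc : c ∈ B := by simpa using (hA' x).1 hx
    exact Set.infinite_univ ((A.finite_toSet).subset fun y _ => by simpa [hA'] using hc)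
  have hP' : derivative P ≠ 0 := fun h' => hdeg (derivative_eq_zero.1 h')
  have hsub (b : k) : (P - C b).natDegree = P.natDegree := natDegree_sub_C
  have hne (b : k) : P - C b ≠ 0 := fun h' => hdeg (by rw [← hsub b, h', natDegree_zero])
  have hroots (b : k) (hb : b ∈ B) : (P - C b).roots.toFinset = A.filter fun a => P.eval a = b := by
    ext a
    simp only [Multiset.mem_toFinset, mem_roots (hne b), IsRoot.def, eval_sub, eval_C, sub_eq_zero,
      Finset.mem_filter, hA']
    exact ⟨fun h' => ⟨h' ▸ hb, h'⟩, fun h' => h'.2⟩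
  -- Each fibre over `B` has `deg P` points with multiplicity, and the fibres make up `A`. The
  -- excess multiplicities are zeros of `P'`, at most `deg P - 1` in all.
  have hsum : ∑ b ∈ B, P.natDegree = ∑ a ∈ A, (P - C (P.eval a)).rootMultiplicity a := by
    rw [← Finset.sum_fiberwise_of_maps_to (s := A) (t := B) (g := fun a => P.eval a)
      fun a ha => (hA' a).1 ha]
    refine Finset.sum_congr rfl fun b hb => ?_
    rw [← hsub b, (IsAlgClosed.splits (P - C b)).natDegree_eq_card_roots,
      ← Multiset.toFinset_sum_count_eq, hroots b hb]
    refine Finset.sum_congr rfl fun a ha => ?_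
    rw [count_roots, (Finset.mem_filter.1 ha).2]
  have hmult (a : k) : (P - C (P.eval a)).rootMultiplicity a ≤ (derivative P).rootMultiplicity a + 1 := by
    have := rootMultiplicity_sub_one_le_derivative_rootMultiplicity (P - C (P.eval a)) a
    rw [derivative_sub, derivative_C, sub_zero] at this
    omega
  have hle : ∑ a ∈ A, (derivative P).rootMultiplicity a ≤ P.natDegree - 1 := by
    calc _ = ∑ a ∈ A, (derivative P).roots.count a := by simp
      _ ≤ (derivative P).roots.card := by
        rw [← Multiset.sum_count_eq_card (s := A ∪ (derivative P).roots.toFinset)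
          fun a ha => Finset.mem_union_right _ (Multiset.mem_toFinset.2 ha)]
        exact Finset.sum_le_sum_of_subset Finset.subset_union_left
      _ ≤ _ := (card_roots' _).trans (natDegree_derivative_le P)
  have h1 : ∑ a ∈ A, (P - C (P.eval a)).rootMultiplicity a ≤ (P.natDegree - 1) + A.card := by
    refine (Finset.sum_le_sum fun a _ => hmult a).trans ?_
    rw [Finset.sum_add_distrib]
    simpa using hle
  rw [← hsum, Finset.sum_const, smul_eq_mul, hcard] at h1
  obtain ⟨d, hd⟩ := Nat.exists_eq_succ_of_ne_zero hdeg
  obtain ⟨m, hm⟩ := Nat.exists_eq_add_of_le hB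
  -- With `deg P = d + 1` and `|B| = 2 + m`, the bound reads `(2 + m)(d + 1) ≤ d + (2 + m)`, forcing
  -- `d = 0`.
  rw [hd, hm, Nat.succ_sub_one] at h1
  rw [hd]
  have : d = 0 := by nlinarith
  rw [this]

end OneVariable

theorem eq_const_of_fin_one {k : Type u} (y : Fin 1 → k) : y = fun _ => y 0 :=
  funext fun i => by rw [Subsingleton.elim i 0]

/-! ### Zariski-open sets and regular functions through standard open sets -/

section Spaces

open scoped Topology

variable {k : Type u} [Field k] {n : ℕ}

theorem isOpen_zariski_iff {U : Set (Fin n → k)} :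
    IsOpen[zariski k n] U ↔ ∀ x ∈ U, ∃ f : MvPolynomial (Fin n) k,
      MvPolynomial.eval x f ≠ 0 ∧ ∀ y, MvPolynomial.eval y f ≠ 0 → y ∈ U := by
  change (∃ S, zeros k n S = Uᶜ) ↔ _
  constructor
  · rintro ⟨S, hS⟩ x hx
    have hx' : x ∉ zeros k n S := by rw [hS]; simpa using hx
    simp only [zeros, Set.mem_ofPred_eq, not_forall] at hx'
    obtain ⟨f, hf, hfx⟩ := hx'
    refine ⟨f, hfx, fun y hy => ?_⟩
    by_contra hyU
    have : y ∈ zeros k n S := by rw [hS]; exact hyU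
    exact hy (this f hf)
  · intro h
    refine ⟨{f | ∀ y, MvPolynomial.eval y f ≠ 0 → y ∈ U}, ?_⟩
    ext x
    constructor
    · intro hx hxU
      obtain ⟨f, hf, hfU⟩ := h x hxU
      exact hf (hx f hfU)
    · intro hx f hf
      by_contra hfx
      exact hx (hf x hfx)

theorem isOpen_subspace_iff {Y : Type u} {ι : Y → (Fin n → k)} {U : Set Y} :
    IsOpen[(subspace ι).topology] U ↔ ∀ x ∈ U, ∃ f : MvPolynomial (Fin n) k,
      MvPolynomial.eval (ι x) f ≠ 0 ∧ ∀ y, MvPolynomial.eval (ι y) f ≠ 0 → y ∈ U := by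
  constructor
  · rintro ⟨U', hU', rfl⟩ x hx
    obtain ⟨f, hf, h⟩ := isOpen_zariski_iff.1 hU' _ hx
    exact ⟨f, hf, fun y hy => h _ hy⟩
  · intro h
    refine ⟨{z | ∃ f : MvPolynomial (Fin n) k, MvPolynomial.eval z f ≠ 0 ∧
      ∀ y, MvPolynomial.eval (ι y) f ≠ 0 → y ∈ U}, isOpen_zariski_iff.2 ?_, ?_⟩
    · rintro z ⟨f, hf, h'⟩
      exact ⟨f, hf, fun y hy => ⟨f, hy, h'⟩⟩
    · ext x
      exact ⟨fun ⟨f, hf, h'⟩ => h' x hf, h x⟩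

/-- Regular functions on an embedded set are locally quotients on standard open sets. -/
theorem mem_regular_subspace_iff {Y : Type u} {ι : Y → (Fin n → k)}
    {U : Opens (subspace ι).carrier} {f : U → k} :
    f ∈ (subspace ι).regular U ↔ ∀ x : U, ∃ g h : MvPolynomial (Fin n) k,
      MvPolynomial.eval (ι x.1) h ≠ 0 ∧ ∀ y : U, MvPolynomial.eval (ι y.1) h ≠ 0 →
        f y = MvPolynomial.eval (ι y.1) g / MvPolynomial.eval (ι y.1) h := by
  constructor
  · intro hf x
    obtain ⟨⟨V, hV⟩, hxV, g, h, H⟩ := hf x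
    obtain ⟨p, hp, hpV⟩ := isOpen_subspace_iff.1 hV x.1 hxV
    -- The factor `p` leaves the fraction unchanged but confines the nonvanishing locus of the
    -- denominator to `V`.
    refine ⟨g * p, h * p, ?_, fun y hy => ?_⟩
    · rw [map_mul]
      exact mul_ne_zero (H x hxV).1 hp
    · rw [map_mul] at hy
      rw [map_mul, map_mul, mul_div_mul_right _ _ (right_ne_zero_of_mul hy)]
      exact (H y (hpV _ (right_ne_zero_of_mul hy))).2
  · intro hf x
    obtain ⟨g, h, hx, H⟩ := hf x
    have hV : IsOpen[(subspace ι).topology] {y | MvPolynomial.eval (ι y) h ≠ 0} :=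
      isOpen_subspace_iff.2 fun y hy => ⟨h, hy, fun _ => id⟩
    exact ⟨@Opens.mk _ (subspace ι).topology _ hV, hx, g, h, fun y hy => ⟨hy, H y hy⟩⟩

theorem isOpen_line_of_finite_compl {U : Set (Fin 1 → k)}
    (hU : {t : k | (fun _ => t) ∉ U}.Finite) : IsOpen[(affineSpace k 1).topology] U := by
  refine isOpen_subspace_iff.2 fun x hx =>
    ⟨∏ t ∈ hU.toFinset, (MvPolynomial.X 0 - MvPolynomial.C t), ?_, fun y hy => ?_⟩
  · simp only [map_prod, Finset.prod_ne_zero_iff, Set.Finite.mem_toFinset]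
    rintro t ht h0
    refine ht ?_
    rw [eq_const_of_fin_one x] at hx
    convert hx
    rw [map_sub, MvPolynomial.eval_X, MvPolynomial.eval_C, sub_eq_zero] at h0
    exact h0.symm
  · by_contra h
    refine hy ?_
    rw [map_prod]
    refine Finset.prod_eq_zero (i := y 0) ?_ (by simp)
    rw [Set.Finite.mem_toFinset, Set.mem_ofPred_eq, ← eq_const_of_fin_one y]
    exact h

end Spaces

/-! ### The affine invariant of a triple -/

section Invariant

open MvPolynomial

variable (k : Type u) [Field k]

/-- The sum of the squares of all differences of coordinates. -/
noncomputable def sqDiffPoly : MvPolynomial (Fin 3) k :=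
  ∑ i, ∑ j, (X i - X j) ^ 2

variable {k}

theorem eval_sqDiffPoly (a : Fin 3 → k) : eval a (sqDiffPoly k) =
    2 * ((a 0 - a 1) ^ 2 + (a 0 - a 2) ^ 2 + (a 1 - a 2) ^ 2) := by
  simp only [sqDiffPoly, Fin.sum_univ_three, map_add, map_pow, map_sub, eval_X]
  ring

theorem eval_discPoly_three (a : Fin 3 → k) : eval a (discPoly k 3) =
    -((a 0 - a 1) * (a 0 - a 2) * (a 1 - a 2)) ^ 2 := by
  have h : (Finset.univ : Finset (Fin 3)).offDiag =
    {(0, 1), (0, 2), (1, 0), (1, 2), (2, 0), (2, 1)} := by decide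
  rw [discPoly, h]
  simp
  ring

theorem isSymmetric_sqDiffPoly : (sqDiffPoly k).IsSymmetric := by
  intro σ
  simp only [sqDiffPoly, map_sum, map_pow, map_sub, rename_X]
  refine (Equiv.sum_comp σ fun i => ∑ j, ((X i : MvPolynomial (Fin 3) k) - X (σ j)) ^ 2).trans ?_
  exact Finset.sum_congr rfl fun i _ =>
    Equiv.sum_comp σ fun j => ((X i : MvPolynomial (Fin 3) k) - X j) ^ 2

theorem isHomogeneous_sqDiffPoly : (sqDiffPoly k).IsHomogeneous 2 :=
  IsHomogeneous.sum _ _ _ fun i _ => IsHomogeneous.sum _ _ _ fun j _ => by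
    simpa using ((isHomogeneous_X k i).sub (isHomogeneous_X k j)).pow 2

theorem translationInvariant_sqDiffPoly : TranslationInvariant (sqDiffPoly k) := by
  intro a t
  simp [sqDiffPoly]

theorem isSymmetric_discPoly (n : ℕ) : (discPoly k n).IsSymmetric := by
  intro σ
  simp only [discPoly, map_prod, map_sub, rename_X]
  exact Finset.prod_equiv (σ.prodCongr σ) (by simp) (by simp)

theorem isHomogeneous_discPoly_three : (discPoly k 3).IsHomogeneous 6 := by
  have := IsHomogeneous.prod (Finset.univ : Finset (Fin 3)).offDiag
    (fun p => (X p.1 - X p.2 : MvPolynomial (Fin 3) k)) (fun _ => 1)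
    fun p _ => (isHomogeneous_X k p.1).sub (isHomogeneous_X k p.2)
  exact this

theorem translationInvariant_discPoly (n : ℕ) : TranslationInvariant (discPoly k n) := by
  intro a t
  simp [discPoly]

theorem _root_.MvPolynomial.IsSymmetric.eval_comp {n : ℕ} {f : MvPolynomial (Fin n) k}
    (hf : f.IsSymmetric) (a : Fin n → k) (σ : Equiv.Perm (Fin n)) :
    eval (fun i => a (σ i)) f = eval a f := by
  conv_rhs => rw [← hf σ, eval_rename]
  rfl

/-- The invariant of a triple of distinct points under affine maps and permutations. -/
noncomputable def jInv (a : Fin 3 → k) : k :=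
  eval a (sqDiffPoly k) ^ 3 / eval a (discPoly k 3)

theorem jInv_comp_perm (a : Fin 3 → k) (σ : Equiv.Perm (Fin 3)) :
    jInv (fun i => a (σ i)) = jInv a := by
  rw [jInv, isSymmetric_sqDiffPoly.eval_comp, (isSymmetric_discPoly 3).eval_comp, jInv]

/-- Translations cancel in differences; scaling multiplies numerator and denominator by the same `α
^ 6`. -/
theorem jInv_affine (a : Fin 3 → k) {α : k} (hα : α ≠ 0) (β : k) :
    jInv (fun i => α * a i + β) = jInv a := by
  simp only [jInv, eval_sqDiffPoly, eval_discPoly_three]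
  rw [← mul_div_mul_left _ (-((a 0 - a 1) * (a 0 - a 2) * (a 1 - a 2)) ^ 2) (pow_ne_zero 6 hα)]
  congr 1 <;> ring

/-- Polynomials in the invariant are quotients of invariant homogeneous polynomials by powers of
the discriminant. -/
theorem exists_eval_eq_mul_eval_jInv (f : MvPolynomial (Fin 1) k) :
    ∃ (r : ℕ) (g : MvPolynomial (Fin 3) k), g.IsSymmetric ∧ g.IsHomogeneous (6 * r) ∧
      TranslationInvariant g ∧ ∀ a : DistinctTuple k 3,
        eval a.1 g = eval a.1 (discPoly k 3) ^ r * eval (fun _ => jInv a.1) f := by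
  induction f using MvPolynomial.induction_on with
  | C c =>
    exact ⟨0, C c, IsSymmetric.C c, isHomogeneous_C _ c, fun a t => by simp, fun a => by simp⟩
  | add p q hp hq =>
    obtain ⟨r, g, hg1, hg2, hg3, hg4⟩ := hp
    obtain ⟨s, h, hh1, hh2, hh3, hh4⟩ := hq
    have hd (m : ℕ) : (discPoly k 3 ^ m).IsSymmetric :=
      pow_mem (S := symmetricSubalgebra (Fin 3) k) (isSymmetric_discPoly 3) m
    refine ⟨r + s, g * discPoly k 3 ^ s + h * discPoly k 3 ^ r,
      (hg1.mul (hd s)).add (hh1.mul (hd r)), IsHomogeneous.add ?_ ?_, fun a t => ?_, fun a => ?_⟩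
    · convert hg2.mul (isHomogeneous_discPoly_three.pow s) using 1; ring
    · convert hh2.mul (isHomogeneous_discPoly_three.pow r) using 1; ring
    · simp only [map_add, map_mul, map_pow]
      rw [hg3 a t, hh3 a t, translationInvariant_discPoly 3 a t]
    · simp only [map_add, map_mul, map_pow, hg4, hh4]
      ring
  | mul_X p i hp =>
    obtain ⟨r, g, hg1, hg2, hg3, hg4⟩ := hp
    refine ⟨r + 1, g * sqDiffPoly k ^ 3, hg1.mul (pow_mem (S := symmetricSubalgebra (Fin 3) k)
      isSymmetric_sqDiffPoly 3), ?_, fun a t => ?_, fun a => ?_⟩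
    · convert hg2.mul (isHomogeneous_sqDiffPoly.pow 3) using 1; ring
    · simp only [map_mul, map_pow]
      rw [hg3 a t, translationInvariant_sqDiffPoly a t]
    · have := a.2
      simp only [map_mul, map_pow, hg4, eval_X, pow_succ _ r]
      rw [mul_assoc, mul_assoc]
      congr 1
      rw [mul_left_comm]
      congr 1
      rw [jInv, mul_div_cancel₀ _ this]

end Invariant

/-! ### Classes of triples are classified by the invariant -/

section Classification

variable {k : Type u} [Field k]

theorem classOf_eq_iff {a b : DistinctTuple k 3} : classOf a = classOf b ↔
    PolRed (Set.range a.1) (Set.range b.1) ∧ PolRed (Set.range b.1) (Set.range a.1) :=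
  ⟨fun h => Quotient.exact h, fun h => Quotient.sound h⟩

theorem toSet_surjective (n : ℕ) : Function.Surjective (toSet : DistinctTuple k n → NSubset k n) := by
  rintro ⟨A, hA⟩
  have hfin : A.Finite := Set.finite_of_encard_eq_coe hA
  have hcard : hfin.toFinset.card = n := by
    rw [hfin.encard_eq_coe_toFinset_card] at hA
    exact_mod_cast hA
  let e := (hfin.toFinset.equivFinOfCardEq hcard).symm
  refine ⟨⟨fun i => (e i).1, (eval_discPoly_ne_zero_iff _).2
    (Subtype.val_injective.comp e.injective)⟩, Subtype.ext ?_⟩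
  change Set.range (Subtype.val ∘ e) = A
  rw [Set.range_comp, e.range_eq_univ, Set.image_univ]
  ext x
  simp

theorem classOf_surjective : Function.Surjective (classOf : DistinctTuple k 3 → _) := by
  intro c
  obtain ⟨A, rfl⟩ := Quotient.exists_rep (c : PolClass k 3)
  obtain ⟨a, rfl⟩ := toSet_surjective 3 A
  exact ⟨a, rfl⟩

theorem DistinctTuple.injective {n : ℕ} (a : DistinctTuple k n) : Function.Injective a.1 :=
  (eval_discPoly_ne_zero_iff a.1).1 a.2

/-- If the coordinates of `a` are mapped to coordinates of `b` by an affine map, then `b` is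
obtained from `a` by this map and a permutation. -/
theorem exists_perm_of_affine {n : ℕ} {a b : DistinctTuple k n} {α β : k} (hα : α ≠ 0)
    (h : ∀ i, ∃ j, α * a.1 i + β = b.1 j) :
    ∃ σ : Equiv.Perm (Fin n), ∀ i, α * a.1 i + β = b.1 (σ i) := by
  choose σ hσ using h
  have hinj : Function.Injective σ := fun i j hij => a.injective <| mul_left_cancel₀ hα <|
    add_right_cancel ((hσ i).trans ((congrArg b.1 hij).trans (hσ j).symm))
  exact ⟨Equiv.ofBijective σ (Finite.injective_iff_bijective.1 hinj), hσ⟩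

theorem classOf_eq_of_affine {a b : DistinctTuple k 3} {α β : k} (hα : α ≠ 0)
    (h : ∀ i, ∃ j, α * a.1 i + β = b.1 j) : classOf a = classOf b := by
  obtain ⟨σ, hσ⟩ := exists_perm_of_affine hα h
  refine classOf_eq_iff.2 ⟨⟨.C α * .X + .C β, ?_⟩, ⟨.C α⁻¹ * (.X - .C β), ?_⟩⟩
  · ext x
    simp only [Set.mem_range, Set.mem_preimage, Polynomial.eval_add, Polynomial.eval_mul,
      Polynomial.eval_C, Polynomial.eval_X]
    constructor
    · rintro ⟨i, rfl⟩
      exact ⟨σ i, (hσ i).symm⟩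
    · rintro ⟨j, hj⟩
      refine ⟨σ.symm j, mul_left_cancel₀ hα (add_right_cancel (b := β) ?_)⟩
      rw [hσ, σ.apply_symm_apply, hj]
  · ext x
    simp only [Set.mem_range, Set.mem_preimage, Polynomial.eval_sub, Polynomial.eval_mul,
      Polynomial.eval_C, Polynomial.eval_X]
    constructor
    · rintro ⟨j, rfl⟩
      refine ⟨σ.symm j, ?_⟩
      rw [eq_inv_mul_iff_mul_eq₀ hα, eq_sub_iff_add_eq, hσ, σ.apply_symm_apply]
    · rintro ⟨i, hi⟩
      rw [eq_inv_mul_iff_mul_eq₀ hα, eq_sub_iff_add_eq, hσ] at hi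
      exact ⟨σ i, hi⟩

theorem jInv_eq_of_classOf_eq [IsAlgClosed k] [CharZero k] {a b : DistinctTuple k 3}
    (h : classOf a = classOf b) : jInv a.1 = jInv b.1 := by
  classical
  obtain ⟨⟨P, hP⟩, -⟩ := classOf_eq_iff.1 h
  have hcard (c : DistinctTuple k 3) : (Finset.univ.image c.1).card = 3 := by
    rw [Finset.card_image_of_injective _ c.injective]; rfl
  have hdeg := natDegree_eq_one_of_preimage P (Finset.univ.image a.1) (Finset.univ.image b.1)
    (by simpa using hP) (by rw [hcard, hcard]) (by rw [hcard]; norm_num)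
  obtain ⟨α, hα, β, rfl⟩ := Polynomial.natDegree_eq_one.1 hdeg
  obtain ⟨σ, hσ⟩ := exists_perm_of_affine (a := a) (b := b) (β := β) hα fun i => by
    have : a.1 i ∈ Set.range a.1 := ⟨i, rfl⟩
    rw [hP] at this
    obtain ⟨j, hj⟩ := this
    exact ⟨j, by simpa using hj.symm⟩
  rw [← jInv_affine a.1 hα β, ← jInv_comp_perm b.1 σ]
  exact congrArg jInv (funext hσ)

/-- The triple `(0, 1, x)`. -/
def legendre (x : k) (h0 : x ≠ 0) (h1 : x ≠ 1) : DistinctTuple k 3 :=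
  ⟨![0, 1, x], by
    rw [eval_discPoly_three]
    simp [h0, sub_ne_zero.2 h1.symm]⟩

theorem exists_classOf_legendre_eq (a : DistinctTuple k 3) :
    ∃ x h0 h1, classOf (legendre x h0 h1) = classOf a := by
  have h01 : a.1 1 - a.1 0 ≠ 0 := sub_ne_zero.2 (a.injective.ne (by decide))
  have h02 : a.1 2 - a.1 0 ≠ 0 := sub_ne_zero.2 (a.injective.ne (by decide))
  have h12 : a.1 2 ≠ a.1 1 := a.injective.ne (by decide)
  refine ⟨(a.1 2 - a.1 0) / (a.1 1 - a.1 0), div_ne_zero h02 h01, ?_,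
    classOf_eq_of_affine (α := a.1 1 - a.1 0) (β := a.1 0) h01 fun i => ⟨i, ?_⟩⟩
  · rw [Ne, div_eq_one_iff_eq h01, sub_left_inj]
    exact h12
  · fin_cases i
    · simp [legendre]
    · simp [legendre]
    · simp [legendre, mul_div_cancel₀ _ h01]

/-- The sum of squares is `4 (x² - x + 1)` here, and the discriminant product is `-x² (x - 1)²`. -/
theorem jInv_legendre [CharZero k] (x : k) (h0 : x ≠ 0) (h1 : x ≠ 1) :
    jInv (legendre x h0 h1).1 = -64 * (x ^ 2 - x + 1) ^ 3 / (x ^ 2 * (x - 1) ^ 2) := by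
  have h1' := sub_ne_zero.2 h1
  have h1'' := sub_ne_zero.2 h1.symm
  simp only [jInv, legendre, eval_sqDiffPoly, eval_discPoly_three, Matrix.cons_val]
  rw [div_eq_div_iff (by simp [h0, h1'']) (by simp [h0, h1'])]
  ring

theorem classOf_legendre_eq [CharZero k] {x y : k} {hx0 : x ≠ 0} {hx1 : x ≠ 1} {hy0 : y ≠ 0}
    {hy1 : y ≠ 1} (h : jInv (legendre x hx0 hx1).1 = jInv (legendre y hy0 hy1).1) :
    classOf (legendre x hx0 hx1) = classOf (legendre y hy0 hy1) := by
  have hx1' := sub_ne_zero.2 hx1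
  have hy1' := sub_ne_zero.2 hy1
  rw [jInv_legendre, jInv_legendre, div_eq_div_iff (by simp [hx0, hx1']) (by simp [hy0, hy1'])] at h
  -- The factors vanish at `y = x`, `1 - x`, `1/x`, `1/(1 - x)`, `(x - 1)/x`, `x/(x - 1)`: the six
  -- Legendre parameters of one triple.
  have key : (y - x) * ((y + x - 1) * ((y * x - 1) * ((y * (1 - x) - 1) * ((y * x - x + 1) *
      (y * (x - 1) - x))))) = 0 := by
    refine mul_left_cancel₀ (show (64 : k) ≠ 0 by norm_num) ?_
    linear_combination -h
  -- An affine map is fixed by the images of `0` and `1`; the six factors match the six choices of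
  -- these in `{0, 1, y}`.
  have main {α β : k} (hα : α ≠ 0) (i j l : Fin 3) (e0 : β = ![0, 1, y] i)
      (e1 : α + β = ![0, 1, y] j) (e2 : α * x + β = ![0, 1, y] l) :
      classOf (legendre x hx0 hx1) = classOf (legendre y hy0 hy1) := by
    refine classOf_eq_of_affine (α := α) (β := β) hα fun m => ?_
    fin_cases m
    · exact ⟨i, by simpa [legendre] using e0⟩
    · exact ⟨j, by simpa [legendre] using e1⟩
    · exact ⟨l, by simpa [legendre] using e2⟩
  simp only [mul_eq_zero] at key
  rcases key with e | e | e | e | e | e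
  · exact main (α := 1) (β := 0) one_ne_zero 0 1 2 (by simp) (by simp)
      (by simp; linear_combination -e)
  · exact main (α := -1) (β := 1) (by simp) 1 0 2 (by simp) (by simp)
      (by simp; linear_combination -e)
  · exact main (α := y) (β := 0) hy0 0 2 1 (by simp) (by simp)
      (by simp; linear_combination e)
  · exact main (α := -y) (β := y) (by simpa) 2 0 1 (by simp) (by simp)
      (by simp; linear_combination e)
  · exact main (α := y - 1) (β := 1) hy1' 1 2 0 (by simp) (by simp)
      (by simp; linear_combination e)
  · exact main (α := 1 - y) (β := y) (sub_ne_zero.2 hy1.symm) 2 1 0 (by simp) (by simp)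
      (by simp; linear_combination -e)

theorem classOf_eq_iff_jInv_eq [IsAlgClosed k] [CharZero k] {a b : DistinctTuple k 3} :
    classOf a = classOf b ↔ jInv a.1 = jInv b.1 := by
  refine ⟨jInv_eq_of_classOf_eq, fun h => ?_⟩
  obtain ⟨x, hx0, hx1, hx⟩ := exists_classOf_legendre_eq a
  obtain ⟨y, hy0, hy1, hy⟩ := exists_classOf_legendre_eq b
  rw [← hx, ← hy]
  apply classOf_legendre_eq
  rw [jInv_eq_of_classOf_eq hx, jInv_eq_of_classOf_eq hy, h]

open Polynomial in
/-- The equation for `x` expressing that `(0, 1, x)` has a given invariant. -/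
theorem exists_monic_legendre [CharZero k] : ∃ Φ : k[X][X], Φ.Monic ∧ Φ.natDegree = 6 ∧
    ∀ t x : k, (Φ.map (evalRingHom t)).eval x = 0 ↔
      ∃ h0 h1, jInv (legendre x h0 h1).1 = t := by
  let Q : k[X][X] := C (C (64⁻¹) * X) * (X ^ 2 * (X - 1) ^ 2)
  have hQ : Q.natDegree ≤ 4 := by simp only [Q]; compute_degree
  let R : k[X][X] := (X ^ 2 - X + 1) ^ 3
  have hR : R.Monic ∧ R.natDegree = 6 := by
    have h : (X ^ 2 - X + 1 : k[X][X]).natDegree = 2 := by compute_degree!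
    have hm : (X ^ 2 - X + 1 : k[X][X]).Monic := by monicity!
    exact ⟨hm.pow 3, by rw [hm.natDegree_pow, h]⟩
  have hlt : Q.natDegree < R.natDegree := by omega
  refine ⟨R + Q, hR.1.add_of_left (degree_lt_degree hlt), ?_, fun t x => ?_⟩
  · rw [natDegree_add_eq_left_of_natDegree_lt hlt, hR.2]
  · have he : ((R + Q).map (evalRingHom t)).eval x =
        (x ^ 2 - x + 1) ^ 3 + 64⁻¹ * t * (x ^ 2 * (x - 1) ^ 2) := by
      simp [R, Q]
    rw [he]
    constructor
    · intro h
      -- At `0` and `1` the equation reads `1 = 0`, so the excluded parameters are never roots.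
      have h0 : x ≠ 0 := by rintro rfl; simp at h
      have h1 : x ≠ 1 := by rintro rfl; simp at h
      refine ⟨h0, h1, ?_⟩
      rw [jInv_legendre, div_eq_iff (by simp [h0, sub_ne_zero.2 h1])]
      linear_combination (-64) * h
    · rintro ⟨h0, h1, h⟩
      rw [jInv_legendre, div_eq_iff (by simp [h0, sub_ne_zero.2 h1])] at h
      linear_combination (-64⁻¹) * h

theorem exists_jInv_legendre_eq [IsAlgClosed k] [CharZero k] (t : k) :
    ∃ x h0 h1, jInv (legendre (k := k) x h0 h1).1 = t := by
  obtain ⟨Φ, hΦ, hd, h⟩ := exists_monic_legendre (k := k)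
  obtain ⟨x, hx⟩ := IsAlgClosed.exists_root (Φ.map (Polynomial.evalRingHom t)) fun h0 => by
    rw [hΦ.degree_map, Polynomial.degree_eq_natDegree hΦ.ne_zero, hd] at h0
    norm_num at h0
  exact ⟨x, (h t x).1 hx⟩

variable (k) in
/-- The invariant identifies the classes with the points of the line. -/
theorem exists_equiv_line [IsAlgClosed k] [CharZero k] :
    ∃ e : (classVariety k 3).carrier ≃ (Fin 1 → k),
      ∀ a : DistinctTuple k 3, e (classOf a) = fun _ => jInv a.1 := by
  choose s hs using classOf_surjective (k := k)
  refine ⟨Equiv.ofBijective (fun c _ => jInv (s c).1) ⟨fun c d h => ?_, fun y => ?_⟩, fun a => ?_⟩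
  · rw [← hs c, ← hs d]
    exact classOf_eq_iff_jInv_eq.2 (congrFun h 0)
  · obtain ⟨x, h0, h1, h⟩ := exists_jInv_legendre_eq (y 0)
    refine ⟨classOf (legendre x h0 h1), ?_⟩
    rw [eq_const_of_fin_one y, ← h]
    exact funext fun _ => jInv_eq_of_classOf_eq (hs _)
  · exact funext fun _ => jInv_eq_of_classOf_eq (hs _)

end Classification

/-! ### The isomorphism with the line and the global functions -/

section Line

open scoped Topology

variable {k : Type u} [Field k]

theorem isOpen_line_iff {U : Set (Fin 1 → k)} : IsOpen[(affineSpace k 1).topology] U ↔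
    ∀ x ∈ U, ∃ f : MvPolynomial (Fin 1) k,
      MvPolynomial.eval x f ≠ 0 ∧ ∀ y, MvPolynomial.eval y f ≠ 0 → y ∈ U :=
  isOpen_subspace_iff (ι := id)

theorem mem_regular_line_iff {U : Opens (affineSpace k 1).carrier} {f : U → k} :
    f ∈ (affineSpace k 1).regular U ↔ ∀ (x : Fin 1 → k) (_ : x ∈ U),
      ∃ g h : MvPolynomial (Fin 1) k, MvPolynomial.eval x h ≠ 0 ∧
        ∀ (y : Fin 1 → k) (hy : y ∈ U), MvPolynomial.eval y h ≠ 0 →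
          f ⟨y, hy⟩ = MvPolynomial.eval y g / MvPolynomial.eval y h := by
  refine (mem_regular_subspace_iff (ι := id)).trans ⟨fun H x hx => ?_, fun H x => ?_⟩
  · obtain ⟨g, h, h1, h2⟩ := H ⟨x, hx⟩
    exact ⟨g, h, h1, fun y hy => h2 ⟨y, hy⟩⟩
  · obtain ⟨g, h, h1, h2⟩ := H x.1 x.2
    exact ⟨g, h, h1, fun y => h2 y.1 y.2⟩

theorem isOpen_distinctTuples_iff {n : ℕ} {U : Set (DistinctTuple k n)} :
    IsOpen[(distinctTuples k n).topology] U ↔ ∀ x ∈ U, ∃ f : MvPolynomial (Fin n) k,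
      MvPolynomial.eval x.1 f ≠ 0 ∧ ∀ y : DistinctTuple k n, MvPolynomial.eval y.1 f ≠ 0 → y ∈ U :=
  isOpen_subspace_iff

theorem isOpen_classVariety_iff {U : Set (classVariety k 3).carrier} :
    IsOpen U ↔ IsOpen[(distinctTuples k 3).topology] (classOf ⁻¹' U) :=
  Iff.rfl

theorem mem_regular_classVariety_iff {U : Opens (classVariety k 3).carrier} {f : U → k} :
    f ∈ (classVariety k 3).regular U ↔ ∀ (a : DistinctTuple k 3) (_ : classOf a ∈ U),
      ∃ g h : MvPolynomial (Fin 3) k, MvPolynomial.eval a.1 h ≠ 0 ∧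
        ∀ (b : DistinctTuple k 3) (hb : classOf b ∈ U), MvPolynomial.eval b.1 h ≠ 0 →
          f ⟨classOf b, hb⟩ = MvPolynomial.eval b.1 g / MvPolynomial.eval b.1 h := by
  refine (mem_regular_subspace_iff (ι := (Subtype.val : DistinctTuple k 3 → _))).trans
    ⟨fun H a ha => ?_, fun H a => ?_⟩
  · obtain ⟨g, h, h1, h2⟩ := H ⟨a, ha⟩
    exact ⟨g, h, h1, fun b hb => h2 ⟨b, hb⟩⟩
  · obtain ⟨g, h, h1, h2⟩ := H a.1 a.2
    exact ⟨g, h, h1, fun b => h2 b.1 b.2⟩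

theorem isOpen_preimage_jInv {U : Set (Fin 1 → k)} (hU : IsOpen[(affineSpace k 1).topology] U) :
    IsOpen[(distinctTuples k 3).topology] {a : DistinctTuple k 3 | (fun _ => jInv a.1) ∈ U} := by
  refine isOpen_distinctTuples_iff.2 fun a ha => ?_
  obtain ⟨f, hf, hfU⟩ := isOpen_line_iff.1 hU _ ha
  obtain ⟨r, g, -, -, -, hg⟩ := exists_eval_eq_mul_eval_jInv f
  refine ⟨g, ?_, fun b hb => hfU _ ?_⟩
  · rw [hg]
    exact mul_ne_zero (pow_ne_zero _ a.2) hf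
  · rw [hg] at hb
    exact right_ne_zero_of_mul hb

/-- The restriction of a polynomial to the triples `(0, 1, x)`. -/
noncomputable def restrictLegendre (f : MvPolynomial (Fin 3) k) : Polynomial k :=
  MvPolynomial.aeval ![0, 1, Polynomial.X] f

theorem eval_restrictLegendre (f : MvPolynomial (Fin 3) k) (x : k) (h0 : x ≠ 0) (h1 : x ≠ 1) :
    (restrictLegendre f).eval x = MvPolynomial.eval (legendre x h0 h1).1 f := by
  induction f using MvPolynomial.induction_on with
  | C c => simp [restrictLegendre]
  | add f g hf hg => simpa [restrictLegendre] using congrArg₂ (· + ·) hf hg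
  | mul_X f i hf =>
    rw [map_mul, ← hf, restrictLegendre, map_mul, Polynomial.eval_mul, ← restrictLegendre]
    fin_cases i <;> simp [legendre]

/-- A polynomial witnessing openness restricts to a nonzero polynomial in `x`, with finitely many
roots; `0` and `1` are the only other exceptions. -/
theorem finite_compl_legendre {U : Set (DistinctTuple k 3)}
    (hU : IsOpen[(distinctTuples k 3).topology] U) {x : k} {h0 : x ≠ 0} {h1 : x ≠ 1}
    (hx : legendre x h0 h1 ∈ U) : {x : k | ∃ h0 h1, legendre x h0 h1 ∈ U}ᶜ.Finite := by
  obtain ⟨f, hf, hfU⟩ := isOpen_distinctTuples_iff.1 hU _ hx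
  have hf0 : restrictLegendre f ≠ 0 := by
    rintro h
    rw [← eval_restrictLegendre, h, Polynomial.eval_zero] at hf
    exact hf rfl
  refine ((Polynomial.finite_setOfPred_isRoot hf0).union (Set.toFinite {0, 1})).subset fun y hy => ?_
  by_contra hc
  simp only [Set.mem_union, Set.mem_ofPred_eq, Set.mem_insert_iff, Set.mem_singleton_iff, not_or,
    Polynomial.IsRoot.def] at hc
  refine hy ⟨hc.2.1, hc.2.2, hfU _ ?_⟩
  rw [← eval_restrictLegendre]
  exact hc.1

theorem eval_aeval_X_zero (A : Polynomial k) (y : Fin 1 → k) :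
    MvPolynomial.eval y (Polynomial.aeval (MvPolynomial.X 0) A) = A.eval (y 0) := by
  rw [← Polynomial.coe_aeval_eq_eval, ← MvPolynomial.coe_aeval_eq_eval, RingHom.coe_coe,
    ← Polynomial.aeval_algHom_apply, MvPolynomial.aeval_X]

theorem isMorphism_line {e : (classVariety k 3).carrier ≃ (Fin 1 → k)}
    (he : ∀ a : DistinctTuple k 3, e (classOf a) = fun _ => jInv a.1) :
    SpaceWithFunctions.IsMorphism (classVariety k 3) (affineSpace k 1) e := by
  have hc : @Continuous _ _ _ (affineSpace k 1).topology e := by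
    refine @Continuous.mk _ _ _ (affineSpace k 1).topology e fun V hV => ?_
    refine isOpen_classVariety_iff.2 ?_
    convert isOpen_preimage_jInv hV using 1
    ext a
    exact iff_of_eq (congrArg (· ∈ V) (he a))
  refine ⟨hc, fun V f hf => mem_regular_classVariety_iff.2 fun a ha => ?_⟩
  have hV (b : DistinctTuple k 3) (hb : e (classOf b) ∈ V) :
      (fun _ => jInv b.1 : Fin 1 → k) ∈ V := by
    rw [← he]; exact hb
  obtain ⟨g, h, h1, h2⟩ := mem_regular_line_iff.1 hf _ (hV a ha)
  obtain ⟨r, g', -, -, -, hg'⟩ := exists_eval_eq_mul_eval_jInv g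
  obtain ⟨s, h', -, -, -, hh'⟩ := exists_eval_eq_mul_eval_jInv h
  -- `g'` and `h'` carry discriminant powers `r` and `s`; crossing them gives both sides the power
  -- `r + s`, which cancels.
  refine ⟨g' * discPoly k 3 ^ s, h' * discPoly k 3 ^ r, ?_, fun b hb hhb => ?_⟩
  · rw [map_mul, map_pow, hh']
    exact mul_ne_zero (mul_ne_zero (pow_ne_zero _ a.2) h1) (pow_ne_zero _ a.2)
  · rw [map_mul, map_pow, hh'] at hhb
    have hb' := right_ne_zero_of_mul (left_ne_zero_of_mul hhb)
    have := h2 _ (hV b hb) hb'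
    rw [map_mul, map_mul, map_pow, map_pow, hg', hh', mul_right_comm, mul_right_comm _ _ (_ ^ r),
      mul_comm (_ ^ s), mul_div_mul_left _ _ (mul_ne_zero (pow_ne_zero _ b.2) (pow_ne_zero _ b.2)),
      ← this]
    exact congrArg f (Subtype.ext (he b))

variable [IsAlgClosed k] [CharZero k]

theorem finite_compl_legendre_of_nonempty {U : Set (Fin 1 → k)} (hne : U.Nonempty)
    (hU : IsOpen[(distinctTuples k 3).topology] {a : DistinctTuple k 3 | (fun _ => jInv a.1) ∈ U}) :
    {x : k | ∃ h0 h1, (fun _ => jInv (legendre x h0 h1).1) ∈ U}ᶜ.Finite := by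
  obtain ⟨y, hy⟩ := hne
  obtain ⟨x, h0, h1, hx⟩ := exists_jInv_legendre_eq (y 0)
  refine finite_compl_legendre hU (x := x) (h0 := h0) (h1 := h1) ?_
  rw [eq_const_of_fin_one y, ← hx] at hy
  exact hy

theorem isOpen_of_isOpen_preimage_jInv {U : Set (Fin 1 → k)}
    (hU : IsOpen[(distinctTuples k 3).topology] {a : DistinctTuple k 3 | (fun _ => jInv a.1) ∈ U}) :
    IsOpen[(affineSpace k 1).topology] U := by
  rcases U.eq_empty_or_nonempty with rfl | hne
  · exact @isOpen_empty _ (affineSpace k 1).topology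
  -- Every value of `t` outside `U` comes from a parameter outside a cofinite set. The junk values
  -- of the formula at `0` and `1` only enlarge the finite image.
  refine isOpen_line_of_finite_compl (((finite_compl_legendre_of_nonempty hne hU).image fun x =>
    -64 * (x ^ 2 - x + 1) ^ 3 / (x ^ 2 * (x - 1) ^ 2)).subset fun t ht => ?_)
  obtain ⟨x, h0, h1, hx⟩ := exists_jInv_legendre_eq t
  refine ⟨x, ?_, ?_⟩
  · rintro ⟨h0', h1', h⟩
    rw [hx] at h
    exact ht h
  · rw [← hx, jInv_legendre]

/-- A function on an open set of the line whose pullback is regular is a global quotient of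
polynomials. -/
theorem exists_eq_div_of_regular_comp_jInv {U : Set (Fin 1 → k)}
    (hU : IsOpen[(affineSpace k 1).topology] U) (f : (Fin 1 → k) → k)
    (hf : ∀ a : DistinctTuple k 3, (fun _ => jInv a.1) ∈ U → ∃ g h : MvPolynomial (Fin 3) k,
      MvPolynomial.eval a.1 h ≠ 0 ∧ ∀ b : DistinctTuple k 3, (fun _ => jInv b.1) ∈ U →
        MvPolynomial.eval b.1 h ≠ 0 →
          f (fun _ => jInv b.1) = MvPolynomial.eval b.1 g / MvPolynomial.eval b.1 h) :
    ∃ A B : Polynomial k, ∀ y ∈ U, B.eval (y 0) ≠ 0 ∧ f y = A.eval (y 0) / B.eval (y 0) := by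
  rcases U.eq_empty_or_nonempty with rfl | hne
  · exact ⟨0, 0, by simp⟩
  obtain ⟨G, H, hGH⟩ := exists_eq_div_of_locally_eq_div
    (finite_compl_legendre_of_nonempty hne (isOpen_preimage_jInv hU))
    (fun x => f fun _ => -64 * (x ^ 2 - x + 1) ^ 3 / (x ^ 2 * (x - 1) ^ 2)) <| by
      rintro x ⟨h0, h1, hx⟩
      obtain ⟨g, h, hh, hgh⟩ := hf _ hx
      refine ⟨restrictLegendre g, restrictLegendre h, by rwa [eval_restrictLegendre], ?_⟩
      rintro y ⟨hy0, hy1, hy⟩ hhy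
      rw [eval_restrictLegendre _ y hy0 hy1] at hhy
      rw [eval_restrictLegendre _ y hy0 hy1, eval_restrictLegendre _ y hy0 hy1, ← hgh _ hy hhy,
        jInv_legendre]
  -- Descend from `x` to `t`: at every root `x` over `t`, the fraction `G / H` takes the same value
  -- `f(t)`.
  obtain ⟨Φ, hΦ, hdeg, h⟩ := exists_monic_legendre (k := k)
  obtain ⟨A, B, hAB⟩ := exists_eq_div_of_eq_div_on_roots Φ hΦ (by rw [hdeg]; norm_num)
    (fun t => f fun _ => t) {t | (fun _ => t) ∈ U} G H <| by
      intro t ht x hx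
      obtain ⟨h0, h1, rfl⟩ := (h t x).1 hx
      have := hGH x ⟨h0, h1, ht⟩
      rwa [← jInv_legendre x h0 h1] at this
  refine ⟨A, B, fun y hy => ?_⟩
  rw [eq_const_of_fin_one y] at hy ⊢
  exact hAB (y 0) hy

theorem isMorphism_line_symm {e : (classVariety k 3).carrier ≃ (Fin 1 → k)}
    (he : ∀ a : DistinctTuple k 3, e (classOf a) = fun _ => jInv a.1) :
    SpaceWithFunctions.IsMorphism (affineSpace k 1) (classVariety k 3) e.symm := by
  have he' (a : DistinctTuple k 3) : e.symm (fun _ => jInv a.1) = classOf a := by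
    rw [← he, e.symm_apply_apply]
  have hc : @Continuous _ _ (affineSpace k 1).topology _ e.symm := by
    refine @Continuous.mk _ _ (affineSpace k 1).topology _ e.symm fun V hV => ?_
    refine isOpen_of_isOpen_preimage_jInv ?_
    convert isOpen_classVariety_iff.1 hV using 1
    ext a
    exact iff_of_eq (congrArg (· ∈ V) (he' a))
  refine ⟨hc, fun V f hf => mem_regular_line_iff.2 fun x hx => ?_⟩
  rw [mem_regular_classVariety_iff] at hf
  classical
  obtain ⟨A, B, hAB⟩ := exists_eq_div_of_regular_comp_jInv (U := e.symm ⁻¹' V)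
    (V.isOpen.preimage hc) (fun y => if hy : e.symm y ∈ V then f ⟨e.symm y, hy⟩ else 0) <| by
      intro a ha
      rw [Set.mem_preimage, he'] at ha
      obtain ⟨g, h, h1, h2⟩ := hf a ha
      refine ⟨g, h, h1, fun b hb hhb => ?_⟩
      rw [Set.mem_preimage, he'] at hb
      simp only [he']
      rw [dif_pos (show classOf b ∈ V from hb)]
      exact h2 b hb hhb
  refine ⟨Polynomial.aeval (MvPolynomial.X 0) A, Polynomial.aeval (MvPolynomial.X 0) B, ?_,
    fun y hy _ => ?_⟩
  · rw [eval_aeval_X_zero]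
    exact (hAB x hx).1
  · rw [eval_aeval_X_zero, eval_aeval_X_zero]
    have := (hAB y hy).2
    rw [dif_pos (show e.symm y ∈ V from hy)] at this
    exact this

/-- Globally regular functions on the line of classes are polynomials in the invariant. -/
theorem exists_eq_eval_jInv_of_mem_globalFunctions {F : (classVariety k 3).carrier → k}
    (hF : F ∈ (classVariety k 3).globalFunctions) :
    ∃ p : Polynomial k, ∀ a, F (classOf a) = p.eval (jInv a.1) := by
  obtain ⟨e, he⟩ := exists_equiv_line k
  have he' (a : DistinctTuple k 3) : e.symm (fun _ => jInv a.1) = classOf a := by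
    rw [← he, e.symm_apply_apply]
  obtain ⟨A, B, hAB⟩ := exists_eq_div_of_regular_comp_jInv (k := k) (U := Set.univ)
    (@isOpen_univ _ (affineSpace k 1).topology) (fun y => F (e.symm y)) <| by
      intro a _
      obtain ⟨g, h, h1, h2⟩ := mem_regular_classVariety_iff.1 hF a trivial
      refine ⟨g, h, h1, fun b _ hb => ?_⟩
      rw [he']
      exact h2 b trivial hb
  -- The denominator is nonzero on all of `k`, so it is a nonzero constant.
  have hB : B.degree = 0 := by
    by_contra hB
    obtain ⟨t, ht⟩ := IsAlgClosed.exists_root B hB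
    exact (hAB (fun _ => t) trivial).1 ht
  rw [Polynomial.eq_C_of_degree_eq_zero hB] at hAB
  refine ⟨A * Polynomial.C (B.coeff 0)⁻¹, fun a => ?_⟩
  rw [← he', (hAB _ trivial).2, Polynomial.eval_mul, Polynomial.eval_C, Polynomial.eval_C,
    div_eq_mul_inv]

theorem mem_globalFunctions_iff (F : (classVariety k 3).carrier → k) :
    F ∈ (classVariety k 3).globalFunctions ↔
      ∃ (r : ℕ) (g : MvPolynomial (Fin 3) k), g.IsSymmetric ∧ g.IsHomogeneous (6 * r) ∧
        TranslationInvariant g ∧ ∀ a : DistinctTuple k 3,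
          F (classOf a) = MvPolynomial.eval a.1 g / MvPolynomial.eval a.1 (discPoly k 3) ^ r := by
  constructor
  · intro hF
    obtain ⟨p, hp⟩ := exists_eq_eval_jInv_of_mem_globalFunctions hF
    obtain ⟨r, g, h1, h2, h3, h4⟩ :=
      exists_eval_eq_mul_eval_jInv (Polynomial.aeval (MvPolynomial.X (R := k) 0) p)
    refine ⟨r, g, h1, h2, h3, fun a => ?_⟩
    rw [h4, eval_aeval_X_zero, mul_div_cancel_left₀ _ (pow_ne_zero _ a.2), hp]
  · rintro ⟨r, g, -, -, -, hg⟩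
    refine mem_regular_classVariety_iff.2 fun a _ => ⟨g, discPoly k 3 ^ r, ?_, fun b _ _ => ?_⟩
    · rw [map_pow]
      exact pow_ne_zero _ a.2
    · rw [map_pow]
      exact hg b

end Line

end PolynomialClasses

theorem mainTheorem3 (k : Type*) [Field k] [IsAlgClosed k] [CharZero k] :
    PolynomialClasses.SpaceWithFunctions.Isomorphic
        (PolynomialClasses.classVariety k 3) (PolynomialClasses.affineSpace k 1) ∧
      ∀ F : (PolynomialClasses.classVariety k 3).carrier → k,
        F ∈ (PolynomialClasses.classVariety k 3).globalFunctions ↔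
          ∃ (r : ℕ) (g : MvPolynomial (Fin 3) k),
            g.IsSymmetric ∧ g.IsHomogeneous (6 * r) ∧
            PolynomialClasses.TranslationInvariant g ∧
            ∀ a : PolynomialClasses.DistinctTuple k 3,
              F (PolynomialClasses.classOf a) =
                MvPolynomial.eval a.1 g /
                  MvPolynomial.eval a.1 (PolynomialClasses.discPoly k 3) ^ r := by
  obtain ⟨e, he⟩ := PolynomialClasses.exists_equiv_line k
  exact ⟨⟨e, PolynomialClasses.isMorphism_line he, PolynomialClasses.isMorphism_line_symm he⟩,
    PolynomialClasses.mem_globalFunctions_iff⟩
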